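/- An $(RL;0S)$-system over a finite terminal alphabet $\Delta$ is a triple $G=(G_1,G_2,R)$ as follows. $G_1$ is a right-linear grammar with terminal alphabet $\Delta$, a finite nonterminal alphabet $N$ disjoint from $\Delta$, an axiom $A_1\in N$, and a finite nonempty set $P_1$ of productions, each of the form $X\to\alpha$ with $X\in N$ and $\alpha\in \Delta\cup N\cup\{\lambda\}\cup \Delta N$, where $\lambda$ is the empty word. $G_2$ is a $0$-sequential grammar: it has a finite alphabet $\Sigma_2$, an axiom $B_1\in\Sigma_2$, and a finite nonempty set $P_2\subseteq\Sigma_2\times\Sigma_2^*$ of productions, each of which may be applied to any one occurrence of its left-hand side in a word. Finally $R\subseteq P_1\times P_2$. One writes $(x_1,x_2)\Rightarrow_G(y_1,y_2)$ if for some $(r_1,r_2)\in R$ the word $y_1$ arises from $x_1=uX$ ($u\in\Delta^*$, $X\in N$) by rewriting the last letter $X$ with $r_1$, and $y_2$ arises from $x_2$ by rewriting one occurrence of a letter with $r_2$. The language of $G$ is $L(G)=\{w\in\Delta^*\mid (A_1,B_1)\Rightarrow_G^*(w,\lambda)\}$. The system $G$ is real-time if $P_1$ contains no chain rule $X\to Y$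 with $X,Y\in N$. Let $\mathcal L_{rt}(RL;0S)$ be the class of the languages generated by real-time $(RL;0S)$-systems. Theorem 3.2. Each language $L\in\mathcal L_{rt}(RL;0S)$ is recognized by an on-line nondeterministic Turing machine (one read-only input tape whose head never moves to the left but may be stationary, and one read-write work tape) which works in $O(\log n)$ space and $O(n\log n)$ time, where $n$ is the length of the input: one and the same machine satisfies both bounds, and on each input of length $n$ every computation visits $O(\log n)$ cells of the work tape and halts within $O(n\log n)$ steps. Consequently $\mathcal L_{rt}(RL;0S)\subseteq NSPACE(\log n)$. -/

import Mathlib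

open Filter Asymptotics

namespace CTS

/-! ### Selective substitution tables -/

/-- The alphabet `Σ ∪ Σ̄`: `Sum.inl a` is the plain letter `a`, `Sum.inr a` the barred letter `ā`. -/
abbrev Marked (A : Type) : Type := A ⊕ A

/-- The letter-to-letter homomorphism `id_Σ`, which erases the bars. -/
def unbar {A : Type} : Marked A → A := Sum.elim id id

/-- A selector is a subset of `(Σ ∪ Σ̄)* Σ̄ (Σ ∪ Σ̄)*`: each of its words has a barred letter. -/
def IsSelector {A : Type} (K : Set (List (Marked A))) : Prop :=
  ∀ z ∈ K, ∃ a : A, Sum.inr a ∈ z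

/-- A table `(Σ, P, K)` with alphabet `A`. A production `(a, v)` stands for `a → v`. -/
structure Table (A : Type) where
  /-- the productions -/
  prod : Finset (A × List A)
  prod_nonempty : prod.Nonempty
  /-- the selector -/
  sel : Set (List (Marked A))
  isSelector : IsSelector sel

/-- `x ⇒^r y` in the table `T`: there are `z = z₁…zₙ` in the selector and words `y₁, …, yₙ`
with `id_Σ(z) = x` and `y = y₁…yₙ`, where `yᵢ = zᵢ` if `zᵢ` is plain, while `zᵢ` is rewritten into
`yᵢ` by the production `r` if `zᵢ` is barred. (As `z` has a barred letter, `n ≥ 1`.) -/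
def Table.DerivesUsing {A : Type} (T : Table A) (r : A × List A) (x y : List A) : Prop :=
  r ∈ T.prod ∧ ∃ z ∈ T.sel, ∃ ys : List (List A), z.map unbar = x ∧ ys.flatten = y ∧
    List.Forall₂ (fun c v => Sum.elim (fun a => v = [a]) (fun a => (a, v) = r) c) z ys

/-! ### Right-linear and 0-sequential grammars -/

/-- The selector `Δ* N̄`: plain terminals followed by one barred nonterminal. -/
def rlSelector (Δ N : Type) : Set (List (Marked (Symbol Δ N))) :=
  {z | ∃ (u : List Δ) (X : N),
    z = u.map (fun a => Sum.inl (Symbol.terminal a)) ++ [Sum.inr (Symbol.nonterminal X)]}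

/-- The selector `Σ* Σ̄ Σ*`: exactly one barred letter, at an arbitrary place. -/
def zsSelector (A : Type) : Set (List (Marked A)) :=
  {z | ∃ (u : List A) (a : A) (v : List A), z = u.map Sum.inl ++ Sum.inr a :: v.map Sum.inl}

/-- A right-linear grammar with terminal alphabet `Δ`; its alphabet is `Symbol Δ N`, the disjoint
union of `Δ` and the nonterminal alphabet `N`. -/
structure RLGrammar (Δ : Type) where
  /-- the nonterminal alphabet -/
  N : Type
  finite : Finite N
  /-- the productions -/
  prod : Finset (Symbol Δ N × List (Symbol Δ N))
  prod_nonempty : prod.Nonempty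
  /-- the axiom -/
  ax : N
  /-- every production is `X → α` with `X` a nonterminal and
  `α` a single symbol, the empty word, or a terminal followed by a nonterminal -/
  rightLinear : ∀ r ∈ prod, (∃ X : N, r.1 = Symbol.nonterminal X) ∧
    ((∃ σ : Symbol Δ N, r.2 = [σ]) ∨ r.2 = [] ∨
      ∃ (a : Δ) (Y : N), r.2 = [Symbol.terminal a, Symbol.nonterminal Y])

/-- The table of a right-linear grammar. -/
def RLGrammar.table {Δ : Type} (G : RLGrammar Δ) : Table (Symbol Δ G.N) where
  prod := G.prod
  prod_nonempty := G.prod_nonempty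
  sel := rlSelector Δ G.N
  isSelector := by
    rintro z ⟨u, X, rfl⟩
    exact ⟨Symbol.nonterminal X, by simp⟩

/-- A right-linear grammar is real-time if it has no chain rule `X → Y`, `X` and `Y` nonterminals. -/
def RLGrammar.IsRealTime {Δ : Type} (G : RLGrammar Δ) : Prop :=
  ∀ X Y : G.N, (Symbol.nonterminal X, [Symbol.nonterminal Y]) ∉ G.prod

/-- A 0-sequential grammar; all letters of its alphabet are nonterminals. -/
structure ZSGrammar where
  /-- the alphabet -/
  A : Type
  finite : Finite A
  /-- the productions -/
  prod : Finset (A × List A)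
  prod_nonempty : prod.Nonempty
  /-- the axiom -/
  ax : A

/-- The table of a 0-sequential grammar. -/
def ZSGrammar.table (G : ZSGrammar) : Table G.A where
  prod := G.prod
  prod_nonempty := G.prod_nonempty
  sel := zsSelector G.A
  isSelector := by
    rintro z ⟨u, a, v, rfl⟩
    exact ⟨a, by simp⟩

/-! ### (RL; 0S)-systems -/

/-- An (RL; 0S)-system `(G₁, G₂, R)` with terminal alphabet `Δ`. -/
structure RL0SSystem (Δ : Type) where
  /-- the right-linear component -/
  G₁ : RLGrammar Δ
  /-- the 0-sequential component -/
  G₂ : ZSGrammar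
  /-- the rewrites -/
  rew : Set ((Symbol Δ G₁.N × List (Symbol Δ G₁.N)) × (G₂.A × List G₂.A))
  rew_subset : ∀ r ∈ rew, r.1 ∈ G₁.prod ∧ r.2 ∈ G₂.prod

/-- Direct derivation: both components are rewritten at once, by the two rules of one rewrite. -/
def RL0SSystem.Derives {Δ : Type} (G : RL0SSystem Δ)
    (x y : List (Symbol Δ G.G₁.N) × List G.G₂.A) : Prop :=
  ∃ r ∈ G.rew, G.G₁.table.DerivesUsing r.1 x.1 y.1 ∧ G.G₂.table.DerivesUsing r.2 x.2 y.2

/-- `L(G) = {w ∈ Δ* | (ax(G₁), ax(G₂)) ⇒* (w, λ)}`. -/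
def RL0SSystem.language {Δ : Type} (G : RL0SSystem Δ) : Language Δ :=
  {w | Relation.ReflTransGen G.Derives
    ([Symbol.nonterminal G.G₁.ax], [G.G₂.ax]) (w.map Symbol.terminal, [])}

/-- The class of real-time (RL; 0S)-languages over the alphabet `Δ`. -/
def LrtRL0S (Δ : Type) : Set (Language Δ) :=
  {L | ∃ G : RL0SSystem Δ, G.G₁.IsRealTime ∧ G.language = L}

/-! ### Nondeterministic Turing machines with a read-only input tape and one work tape -/

/-- What the input head can read: the letters and the two end markers. -/
inductive InSym (α : Type) where
  | leftEnd
  | letter (a : α)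
  | rightEnd

/-- Head movements. -/
inductive Move where
  | left
  | stay
  | right

/-- The new position of a head on a tape whose leftmost cell is `0`; a left move on the leftmost
cell has no effect. -/
def Move.apply : Move → ℕ → ℕ
  | .left, p => p - 1
  | .stay, p => p
  | .right, p => p + 1

/-- A nondeterministic Turing machine with a two-way read-only input tape and one read-write work
tape, infinite to the right. An element `(q, g, m, m')` of `δ q₀ x g₀` allows the machine, in the
state `q₀` and reading `x` on the input tape and `g₀` on the work tape, to go to the state `q`, to
write `g` on the work tape, and to move the input head by `m` and the work head by `m'`. -/
structure NTM (α : Type) where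
  /-- the states -/
  Q : Type
  finite_Q : Finite Q
  /-- the work tape alphabet -/
  Γ : Type
  finite_Γ : Finite Γ
  /-- the blank of the work tape -/
  blank : Γ
  /-- the initial state -/
  start : Q
  /-- the accepting states -/
  accept : Set Q
  /-- the transition relation -/
  δ : Q → InSym α → Γ → Set (Q × Γ × Move × Move)

namespace NTM

variable {α : Type} (M : NTM α)

/-- A configuration. -/
structure Cfg where
  /-- the current state -/
  state : M.Q
  /-- the position of the input head -/
  inPos : ℕ
  /-- the contents of the work tape -/
  tape : ℕ → M.Γ
  /-- the position of the work head -/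
  head : ℕ

/-- The input tape for `w = a₁…aₙ`: the left end marker in the cell `0`, the letter `aᵢ` in the
cell `i`, and the right end marker in the cell `n + 1`. -/
def inputAt (w : List α) : ℕ → InSym α
  | 0 => InSym.leftEnd
  | p + 1 => (w[p]?).elim InSym.rightEnd InSym.letter

/-- The initial configuration: the input head is on the cell `1`, the work tape is blank. -/
def init : M.Cfg := ⟨M.start, 1, fun _ => M.blank, 0⟩

/-- One step on the input `w`. The input head never goes beyond the right end marker. -/
def Step (w : List α) (c c' : M.Cfg) : Prop :=
  ∃ (q : M.Q) (g : M.Γ) (m m' : Move),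
    (q, g, m, m') ∈ M.δ c.state (inputAt w c.inPos) (c.tape c.head) ∧
    c' = ⟨q, min (m.apply c.inPos) (w.length + 1), Function.update c.tape c.head g,
      m'.apply c.head⟩

/-- Some computation on the input `w` is in the configuration `c` after `k` steps. -/
inductive ReachesIn (w : List α) : ℕ → M.Cfg → Prop
  | zero : ReachesIn w 0 M.init
  | succ {k : ℕ} {c c' : M.Cfg} : ReachesIn w k c → M.Step w c c' → ReachesIn w (k + 1) c'

/-- The accepted language: some computation on `w` enters an accepting state. -/
def language : Language α :=
  {w | ∃ (k : ℕ) (c : M.Cfg), M.ReachesIn w k c ∧ c.state ∈ M.accept}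

/-- On-line machine: the input head never moves to the left (it may be stationary). -/
def OnLine : Prop :=
  ∀ q x g, ∀ tr ∈ M.δ q x g, tr.2.2.1 ≠ Move.left

/-- On each input `w`, every computation visits at most `s |w|` cells of the work tape. (The cells
visited by a computation are those from `0` to its rightmost head position.) -/
def SpaceBounded (s : ℕ → ℕ) : Prop :=
  ∀ w k c, M.ReachesIn w k c → c.head + 1 ≤ s w.length

/-- On each input `w`, every computation halts after at most `t |w|` steps. -/
def TimeBounded (t : ℕ → ℕ) : Prop :=
  ∀ w k c, M.ReachesIn w k c → k ≤ t w.length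

end NTM

/-- `NSPACE(f)`, for languages over the alphabet `α`. -/
def NSPACE (α : Type) (f : ℕ → ℝ) : Set (Language α) :=
  {L | ∃ (M : NTM α) (s : ℕ → ℕ), M.language = L ∧ M.SpaceBounded s ∧
    (fun n => (s n : ℝ)) =O[atTop] f}

end CTS

/-! In the second component only the number of occurrences of each letter matters: a rule may be
applied to any occurrence, and the target is the empty word. A system therefore behaves like a
finite automaton with counters. The letter to be rewritten next is guessed and kept in the finite
state, so all counters start at `0`, and the guess is legitimate exactly when the counters stay
nonnegative.

In a real-time system every derivation step that leaves a nonterminal produces a terminal. A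
successful derivation thus has at most `n + 1` steps, the counters are `O(n)`, and `O(log n)` binary
digits suffice. With all counters on parallel tracks, a transition costs one sweep to the right,
which adds a bounded vector by carry propagation, and one way back; this gives `O(n log n)` time in
total. Branches that would make a counter negative get stuck at the top of the number.

`Inv.step` yields soundness and both bounds, `Reach.exists_reachesIn` yields completeness, and
`toCounterSystem_language` links grammar systems to counter systems. -/

namespace CTS

/-! ### Counter systems -/

/-- A nondeterministic system of counters which reads a letter in each transition, except possibly
in the last one. The state `none` is the final one. -/
structure CounterSystem (Δ : Type) where
  /-- the states from which a transition is possible -/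
  State : Type
  finite_State : Finite State
  /-- the index set of the counters -/
  Coord : Type
  finite_Coord : Finite Coord
  /-- the initial state -/
  start : State
  /-- the transitions: the letter read (if any), the change of the counters, and the new state -/
  trans : State → Option Δ → (Coord → ℤ) → Option State → Prop
  /-- a bound of the changes of the counters -/
  bound : ℕ
  one_le_bound : 1 ≤ bound
  change_mem : ∀ p o d q, trans p o d q → ∀ i, d i ∈ Set.Icc (-(bound : ℤ)) bound
  eq_none_of_trans_none : ∀ p d q, trans p none d q → q = none

namespace CounterSystem

variable {Δ : Type} (V : CounterSystem Δ)

/-- `V.Reach j u q v`: reading `u` in `j` transitions, the system can get from the initial state with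
all counters `0` to the state `q` with the counters `v`. -/
inductive Reach : ℕ → List Δ → Option V.State → (V.Coord → ℕ) → Prop
  | zero : Reach 0 [] (some V.start) 0
  | step {j : ℕ} {u : List Δ} {p : V.State} {v v' : V.Coord → ℕ} {o : Option Δ}
      {d : V.Coord → ℤ} {q : Option V.State} : Reach j u (some p) v → V.trans p o d q →
      (∀ i, (v' i : ℤ) = v i + d i) → Reach (j + 1) (u ++ o.toList) q v'

/-- The accepted language: acceptance in the final state with all counters `0`. -/
def language : Language Δ :=
  {w | ∃ j, V.Reach j w none 0}

variable {V}

/-- A transition without a letter leads to the final state, which has no successor. This is where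
the real-time property enters the bounds. -/
theorem Reach.eq_length {j : ℕ} {u : List Δ} {q : Option V.State} {v : V.Coord → ℕ}
    (h : V.Reach j u q v) : q ≠ none → j = u.length := by
  induction h with
  | zero => simp
  | @step j u p v v' o d q _ ht _ ih =>
    intro hq
    have := ih (by simp)
    cases o with
    | none => exact absurd (V.eq_none_of_trans_none _ _ _ ht) hq
    | some a => simp [this]

theorem Reach.le_length {j : ℕ} {u : List Δ} {q : Option V.State} {v : V.Coord → ℕ}
    (h : V.Reach j u q v) : j ≤ u.length + 1 := by
  cases h with
  | zero => simp
  | step h _ _ =>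
    have := h.eq_length (by simp)
    simp [this]

theorem Reach.le_bound {j : ℕ} {u : List Δ} {q : Option V.State} {v : V.Coord → ℕ}
    (h : V.Reach j u q v) (i : V.Coord) : (v i : ℤ) ≤ V.bound * j := by
  induction h with
  | zero => simp
  | step _ ht hv ih =>
    have := (V.change_mem _ _ _ _ ht i).2
    rw [hv]; push_cast; linarith

variable (V)

/-! ### The machine of a counter system -/

/-- The symbols on the work tape: the cell `0` carries the mark, and the cell `j + 1` carries the
binary digits of weight `2 ^ j` of all counters. -/
inductive Cell (A : Type) where
  | blank
  | mark
  | bits (f : A → Bool)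

instance (A : Type) [Finite A] : Finite (Cell A) :=
  Finite.of_surjective
    (fun x : Option (Option (A → Bool)) => x.elim Cell.blank fun y => y.elim Cell.mark Cell.bits)
    (by
      rintro (_ | _ | f)
      exacts [⟨none, rfl⟩, ⟨some none, rfl⟩, ⟨some (some f), rfl⟩])

/-- The digit of the counter `i` in a cell. -/
def Cell.digit {A : Type} : Cell A → A → ℤ
  | bits f, i => (f i).toInt
  | _, _ => 0

/-- The carries which occur in an addition. -/
abbrev Carry : Type := V.Coord → Set.Icc (-(V.bound : ℤ)) V.bound

/-- The states of the machine. -/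
inductive MState where
  | start
  /-- on the way back to the mark -/
  | back (q : Option V.State)
  /-- adding to the counters, from the lowest digits to the highest ones -/
  | sweep (q : Option V.State) (κ : V.Carry)
  | accept

instance : Finite V.MState := by
  have := V.finite_State
  have := V.finite_Coord
  refine Finite.of_surjective
    (fun x : Option (Option (Option V.State ⊕ (Option V.State × V.Carry))) =>
      x.elim MState.start fun y => y.elim MState.accept
        (Sum.elim MState.back fun z => MState.sweep z.1 z.2)) ?_
  rintro (_ | q | ⟨q, κ⟩ | _)
  exacts [⟨none, rfl⟩, ⟨some (some (.inl q)), rfl⟩, ⟨some (some (.inr (q, κ))), rfl⟩,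
    ⟨some none, rfl⟩]

/-- The transitions of the machine. -/
inductive Trans : V.MState → InSym Δ → Cell V.Coord → V.MState → Cell V.Coord → Move → Move → Prop
  | init (x : InSym Δ) (g : Cell V.Coord) :
      Trans .start x g (.back (some V.start)) .mark .stay .stay
  -- The change of the counters is loaded as the incoming carry at the digit of weight `1`.
  | read {p : V.State} {a : Δ} {q : Option V.State} {κ : V.Carry} :
      V.trans p (some a) (fun i => κ i) q →
      Trans (.back (some p)) (.letter a) .mark (.sweep q κ) .mark .right .right
  -- The end of the input is not tested here but in `accept`.
  | finish {p : V.State} {q : Option V.State} {κ : V.Carry} (x : InSym Δ) :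
      V.trans p none (fun i => κ i) q →
      Trans (.back (some p)) x .mark (.sweep q κ) .mark .stay .right
  -- The way back in the final state doubles as the zero test.
  | back {q : Option V.State} {f : V.Coord → Bool} (x : InSym Δ) :
      (q = none → ∀ i, f i = false) → Trans (.back q) x (.bits f) (.back q) (.bits f) .stay .left
  | add {q : Option V.State} {κ κ' : V.Carry} {f f' : V.Coord → Bool} (x : InSym Δ) :
      (∀ i, (f i).toInt + (κ i : ℤ) = (f' i).toInt + 2 * (κ' i : ℤ)) →
      Trans (.sweep q κ) x (.bits f) (.sweep q κ') (.bits f') .stay .right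
  -- On the first blank a negative carry means a negative counter; neither `extend` nor `turn` then
  -- applies, and the branch dies.
  | extend {q : Option V.State} {κ κ' : V.Carry} {f' : V.Coord → Bool} (x : InSym Δ) :
      (∀ i, 0 ≤ (κ i : ℤ)) → (∃ i, 0 < (κ i : ℤ)) →
      (∀ i, (κ i : ℤ) = (f' i).toInt + 2 * (κ' i : ℤ)) →
      Trans (.sweep q κ) x .blank (.sweep q κ') (.bits f') .stay .right
  | turn {q : Option V.State} {κ : V.Carry} (x : InSym Δ) :
      (∀ i, (κ i : ℤ) = 0) → Trans (.sweep q κ) x .blank (.back q) .blank .stay .left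
  | accept : Trans (.back none) .rightEnd .mark .accept .mark .stay .stay

/-- The machine of a counter system: it keeps the counters in binary on parallel tracks. -/
def toNTM : NTM Δ where
  Q := V.MState
  finite_Q := inferInstance
  Γ := Cell V.Coord
  finite_Γ := by have := V.finite_Coord; infer_instance
  blank := .blank
  start := .start
  accept := {.accept}
  δ q x g := {r | V.Trans q x g r.1 r.2.1 r.2.2.1 r.2.2.2}

theorem toNTM_onLine : V.toNTM.OnLine := by
  rintro q x g ⟨q', g', m, m'⟩ h
  change V.Trans q x g q' g' m m' at h
  change m ≠ Move.left
  cases h <;> simp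

/-! ### Work tapes as counters -/

/-- The cells `1, …, L` carry digits, and all later cells are blank. -/
structure IsCounterTape {A : Type} (T : ℕ → Cell A) (L : ℕ) : Prop where
  mark : T 0 = .mark
  bits : ∀ j < L, ∃ f, T (j + 1) = .bits f
  blank : ∀ j, L ≤ j → T (j + 1) = .blank

/-- The value of the counter `i`. -/
def tapeValue {A : Type} (T : ℕ → Cell A) (L : ℕ) (i : A) : ℤ :=
  ∑ j ∈ Finset.range L, (T (j + 1)).digit i * 2 ^ j

theorem Cell.digit_nonneg {A : Type} (g : Cell A) (i : A) : 0 ≤ g.digit i := by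
  cases g with
  | bits f => cases h : f i <;> simp [Cell.digit, h]
  | _ => simp [Cell.digit]

theorem Cell.digit_le_one {A : Type} (g : Cell A) (i : A) : g.digit i ≤ 1 := by
  cases g with
  | bits f => cases h : f i <;> simp [Cell.digit, h]
  | _ => simp [Cell.digit]

section Tape

variable {A : Type} {T : ℕ → Cell A} {L h : ℕ}

theorem tapeValue_nonneg (i : A) : 0 ≤ tapeValue T L i :=
  Finset.sum_nonneg fun j _ => mul_nonneg (Cell.digit_nonneg _ _) (by positivity)

theorem digit_eq_zero_of_tapeValue (i : A) (h0 : tapeValue T L i = 0) {j : ℕ} (hj : j < L) :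
    (T (j + 1)).digit i = 0 := by
  have := (Finset.sum_eq_zero_iff_of_nonneg fun j _ =>
    mul_nonneg (Cell.digit_nonneg (T (j + 1)) i) (by positivity)).1 h0 j (Finset.mem_range.2 hj)
  simpa using this

theorem tapeValue_eq_zero (i : A) (h0 : ∀ j, (T (j + 1)).digit i = 0) : tapeValue T L i = 0 := by
  simp [tapeValue, h0]

theorem isCounterTape_mark :
    IsCounterTape (Function.update (fun _ => .blank : ℕ → Cell A) 0 .mark) 0 :=
  ⟨by simp, by simp, fun j _ => by simp⟩

/-- The maximum treats together overwriting a digit (`h < L`) and appending a new highest one (`h =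
L`). -/
theorem IsCounterTape.update (hT : IsCounterTape T L) (hL : h ≤ L) (f : A → Bool) :
    IsCounterTape (Function.update T (h + 1) (.bits f)) (max L (h + 1)) := by
  refine ⟨by simpa using hT.mark, fun j hj => ?_, fun j hj => ?_⟩
  · by_cases hjh : j = h
    · exact ⟨f, by simp [hjh]⟩
    · obtain ⟨f', hf'⟩ := hT.bits j (by omega)
      exact ⟨f', by simpa [Function.update_apply, hjh] using hf'⟩
  · have hjh : j ≠ h := by omega
    simpa [Function.update_apply, hjh] using hT.blank j (by omega)

theorem IsCounterTape.tapeValue_max (hT : IsCounterTape T L) (hL : h ≤ L) (i : A) :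
    tapeValue T (max L (h + 1)) i = tapeValue T L i := by
  rcases hL.lt_or_eq with hlt | rfl
  · rw [max_eq_left hlt]
  · rw [max_eq_right (Nat.le_succ h), tapeValue, Finset.sum_range_succ, hT.blank h le_rfl]
    simp [Cell.digit, tapeValue]

theorem IsCounterTape.tapeValue_update (hT : IsCounterTape T L) (hL : h ≤ L) (f : A → Bool)
    (i : A) : tapeValue (Function.update T (h + 1) (.bits f)) (max L (h + 1)) i =
      tapeValue T L i + ((f i).toInt - (T (h + 1)).digit i) * 2 ^ h := by
  rw [← hT.tapeValue_max hL i, ← sub_eq_iff_eq_add', tapeValue, tapeValue,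
    ← Finset.sum_sub_distrib, Finset.sum_eq_single_of_mem h (by simp)]
  · simp [Cell.digit, sub_mul]
  · intro j _ hj
    simp [hj]

/-- Writing a digit and passing on the carry preserves the sum. -/
theorem IsCounterTape.tapeValue_update_add (hT : IsCounterTape T L) (hL : h ≤ L) {f : A → Bool}
    {i : A} {c c' z : ℤ} (hc : (T (h + 1)).digit i + c = (f i).toInt + 2 * c')
    (hz : tapeValue T L i + c * 2 ^ h = z) :
    tapeValue (Function.update T (h + 1) (.bits f)) (max L (h + 1)) i + c' * 2 ^ (h + 1) = z := by
  rw [hT.tapeValue_update hL, pow_succ]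
  linear_combination hz - 2 ^ h * hc

end Tape

/-! ### Bounds and the invariant -/

/-- The bound of the number of digits. -/
def maxDigits (n : ℕ) : ℕ := Nat.log 2 (V.bound * (n + 1)) + 1

/-- The space bound. -/
def space (n : ℕ) : ℕ := V.maxDigits n + 2

/-- The time bound. -/
def time (n : ℕ) : ℕ := 2 + (n + 1) * (2 * V.space n)

/-- What holds for a configuration after `k` steps on the input `w`. -/
def Inv (w : List Δ) (k : ℕ) (c : V.toNTM.Cfg) : Prop :=
  match (c.state : V.MState) with
  | .start => k = 0 ∧ c = V.toNTM.init
  | .back q => ∃ j m L v, V.Reach j (w.take m) q v ∧ m ≤ w.length ∧ c.inPos = m + 1 ∧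
      L ≤ V.maxDigits w.length ∧ IsCounterTape c.tape L ∧ c.head ≤ L ∧
      (∀ i, tapeValue c.tape L i = v i) ∧
      (q = none → ∀ l, c.head ≤ l → ∀ i, Cell.digit (c.tape (l + 1)) i = 0) ∧
      -- The `c.head` steps still needed to return to the mark are charged in advance.
      k + c.head ≤ 1 + j * (2 * V.space w.length)
  | .sweep q κ => ∃ (j m L h : ℕ) (z : V.Coord → ℤ),
      -- `z` is the intended result of the addition. It may have negative entries, noticed only at
      -- the end of the sweep; the clause is then vacuous.
      (∀ v : V.Coord → ℕ, (∀ i, (v i : ℤ) = z i) → V.Reach (j + 1) (w.take m) q v) ∧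
      m ≤ w.length ∧ j ≤ w.length ∧ (∀ i, z i ≤ V.bound * (j + 1)) ∧ c.inPos = m + 1 ∧
      L ≤ V.maxDigits w.length ∧ IsCounterTape c.tape L ∧ c.head = h + 1 ∧ h ≤ L ∧
      (∀ i, tapeValue c.tape L i + (κ i : ℤ) * 2 ^ h = z i) ∧
      k ≤ 1 + j * (2 * V.space w.length) + c.head
  | .accept => w ∈ V.language ∧ k ≤ V.time w.length ∧ c.head = 0

variable {V}

/-! ### Soundness and resource bounds of the machine -/

theorem inputAt_succ_eq_letter {w : List Δ} {m : ℕ} {a : Δ}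
    (h : NTM.inputAt w (m + 1) = .letter a) : ∃ hm : m < w.length, w[m] = a := by
  simp only [NTM.inputAt] at h
  rcases lt_or_ge m w.length with hm | hm
  · simp only [List.getElem?_eq_getElem hm, Option.elim_some, InSym.letter.injEq] at h
    exact ⟨hm, h⟩
  · simp [List.getElem?_eq_none hm] at h

theorem inputAt_succ_eq_rightEnd {w : List Δ} {m : ℕ}
    (h : NTM.inputAt w (m + 1) = .rightEnd) : w.length ≤ m := by
  by_contra! hm
  simp [NTM.inputAt, List.getElem?_eq_getElem hm] at h

/-- A positive carry out of `L` digits forces a counter to be at least `2 ^ L`, while counters are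
at most linear in `n`. So the number never grows beyond `maxDigits`, even on branches that fail
later. -/
theorem le_log_of_carry {L n j : ℕ} {t c z : ℤ} (ht : 0 ≤ t) (hc : 0 < c)
    (hz : t + c * 2 ^ L = z) (hzb : z ≤ V.bound * (j + 1)) (hj : j ≤ n) :
    L + 1 ≤ V.maxDigits n := by
  have h1 : (2 : ℤ) ^ L ≤ V.bound * (n + 1) := by
    have h2 : (2 : ℤ) ^ L ≤ c * 2 ^ L := le_mul_of_one_le_left (by positivity) hc
    have h3 : (V.bound : ℤ) * (j + 1) ≤ V.bound * (n + 1) := by gcongr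
    linarith
  have h2 : 2 ^ L ≤ V.bound * (n + 1) := by exact_mod_cast h1
  exact Nat.succ_le_succ (Nat.le_log_of_pow_le (by norm_num) h2)

theorem Inv.step {w : List Δ} {k : ℕ} {c c' : V.toNTM.Cfg} (hc : V.Inv w k c)
    (hs : V.toNTM.Step w c c') : V.Inv w (k + 1) c' := by
  obtain ⟨s, pos, T, hd⟩ := c
  obtain ⟨s', g, m₁, m₂, ht, rfl⟩ := hs
  change V.Trans s (NTM.inputAt w pos) (T hd) s' g m₁ m₂ at ht
  generalize hx : NTM.inputAt w pos = x at ht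
  generalize hg : T hd = g₀ at ht
  cases ht with
  | init =>
    obtain ⟨rfl, h⟩ := hc
    cases h
    refine ⟨0, 0, 0, 0, by simpa using Reach.zero, by simp, by simp [Move.apply], by simp,
      isCounterTape_mark,
      by simp [Move.apply], by simp [tapeValue], by simp, by simp [Move.apply]⟩
  | @read p a q κ htr =>
    obtain ⟨j, m, L, v, hR, hm, hpos, hL, hT, hhd, hv, -, hk⟩ := hc
    dsimp only at hpos hT hhd hv hk
    subst hpos
    obtain ⟨hm', rfl⟩ := inputAt_succ_eq_letter hx
    -- The mark occurs only in the cell `0`, as the cells `1, …, L` carry digits.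
    have hd0 : hd = 0 := by
      by_contra hne
      obtain ⟨l, rfl⟩ := Nat.exists_eq_succ_of_ne_zero hne
      obtain ⟨f, hf⟩ := hT.bits l (by omega)
      rw [Nat.succ_eq_add_one, hf] at hg
      cases hg
    subst hd0
    have hj := hR.eq_length (by simp)
    rw [List.length_take, min_eq_left hm] at hj
    refine ⟨j, m + 1, L, 0, fun i => v i + κ i, ?_, hm', by omega, ?_, ?_, hL, ?_, rfl, by omega,
      ?_, ?_⟩
    · intro v' hv'
      have := hR.step htr hv'
      rwa [Option.toList_some, List.take_concat_get' w m hm'] at this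
    · intro i
      have h1 := hR.le_bound i
      have h2 := (κ i).2.2
      linarith
    · simp only [Move.apply]; omega
    · simpa only [← hg, Function.update_eq_self] using hT
    · intro i
      simp only [← hg, Function.update_eq_self, hv]; simp
    · simp only [Move.apply]; omega
  | @finish p q κ _ htr =>
    obtain ⟨j, m, L, v, hR, hm, hpos, hL, hT, hhd, hv, -, hk⟩ := hc
    dsimp only at hpos hT hhd hv hk
    subst hpos
    have hd0 : hd = 0 := by
      by_contra hne
      obtain ⟨l, rfl⟩ := Nat.exists_eq_succ_of_ne_zero hne
      obtain ⟨f, hf⟩ := hT.bits l (by omega)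
      rw [Nat.succ_eq_add_one, hf] at hg
      cases hg
    subst hd0
    have hj := hR.eq_length (by simp)
    rw [List.length_take, min_eq_left hm] at hj
    refine ⟨j, m, L, 0, fun i => v i + κ i, ?_, hm, by omega, ?_, ?_, hL, ?_, rfl, by omega,
      ?_, ?_⟩
    · intro v' hv'
      simpa using hR.step htr hv'
    · intro i
      have h1 := hR.le_bound i
      have h2 := (κ i).2.2
      linarith
    · simp only [Move.apply]; omega
    · simpa only [← hg, Function.update_eq_self] using hT
    · intro i
      simp only [← hg, Function.update_eq_self, hv]; simp
    · simp only [Move.apply]; omega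
  | @back q f _ hf =>
    obtain ⟨j, m, L, v, hR, hm, hpos, hL, hT, hhd, hv, hz, hk⟩ := hc
    dsimp only at hpos hT hhd hv hz hk
    subst hpos
    cases hd with
    | zero => rw [hT.mark] at hg; cases hg
    | succ l =>
      refine ⟨j, m, L, v, hR, hm, ?_, hL, ?_, ?_, ?_, ?_, ?_⟩
      · simp only [Move.apply]; omega
      · simpa only [← hg, Function.update_eq_self] using hT
      · simp only [Move.apply]; omega
      · simpa only [← hg, Function.update_eq_self] using hv
      · intro hq l' hl' i
        simp only [Move.apply] at hl'
        simp only [← hg, Function.update_eq_self]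
        rcases Nat.lt_or_ge l l' with h | h
        · exact hz hq l' h i
        · obtain rfl : l' = l := by omega
          simp [hg, Cell.digit, hf hq i]
      · simp only [Move.apply]; omega
  | @add q κ κ' f f' _ hf =>
    obtain ⟨j, m, L, h, z, hz, hm, hj, hzb, hpos, hL, hT, hhd, hh, hv, hk⟩ := hc
    dsimp only at hpos hT hhd hv hk
    subst hpos hhd
    have hlt : h < L := by
      by_contra! hle
      rw [hT.blank h hle] at hg
      cases hg
    refine ⟨j, m, max L (h + 1), h + 1, z, hz, hm, hj, hzb, ?_, by omega, hT.update hh f', rfl,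
      by omega, fun i => hT.tapeValue_update_add hh ?_ (hv i), ?_⟩
    · simp only [Move.apply]; omega
    · rw [hg]; exact hf i
    · simp only [Move.apply]; omega
  | @extend q κ κ' f' _ h0 hpos' hf =>
    obtain ⟨j, m, L, h, z, hz, hm, hj, hzb, hpos, hL, hT, hhd, hh, hv, hk⟩ := hc
    dsimp only at hpos hT hhd hv hk
    subst hpos hhd
    have heq : h = L := by
      by_contra hne
      obtain ⟨f, hf⟩ := hT.bits h (by omega)
      rw [hf] at hg
      cases hg
    obtain ⟨i₀, hi₀⟩ := hpos'
    have hL' : L + 1 ≤ V.maxDigits w.length :=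
      le_log_of_carry (tapeValue_nonneg i₀) hi₀ (heq ▸ hv i₀) (hzb i₀) hj
    refine ⟨j, m, max L (h + 1), h + 1, z, hz, hm, hj, hzb, ?_, by omega, hT.update hh f', rfl,
      by omega, fun i => hT.tapeValue_update_add hh ?_ (hv i), ?_⟩
    · simp only [Move.apply]; omega
    · rw [hg]; simpa [Cell.digit] using hf i
    · simp only [Move.apply]; omega
  | @turn q κ _ h0 =>
    obtain ⟨j, m, L, h, z, hz, hm, hj, hzb, hpos, hL, hT, hhd, hh, hv, hk⟩ := hc
    dsimp only at hpos hT hhd hv hk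
    subst hpos hhd
    have heq : h = L := by
      by_contra hne
      obtain ⟨f, hf⟩ := hT.bits h (by omega)
      rw [hf] at hg
      cases hg
    subst heq
    -- With no carry left the digits alone represent `z`. Hence `z` is nonnegative and the pending
    -- transition is legitimate.
    have hz' : ∀ i, tapeValue T h i = z i := fun i => by simpa [h0] using hv i
    have hnat : ∀ i, ((tapeValue T h i).toNat : ℤ) = tapeValue T h i := fun i =>
      Int.toNat_of_nonneg (tapeValue_nonneg i)
    refine ⟨j + 1, m, h, fun i => (tapeValue T h i).toNat, hz _ fun i => (hnat i).trans (hz' i), hm,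
      ?_, hL, ?_, by simp [Move.apply], ?_, ?_, ?_⟩
    · simp only [Move.apply]; omega
    · simpa only [← hg, Function.update_eq_self] using hT
    · simpa only [← hg, Function.update_eq_self] using fun i => (hnat i).symm
    · intro _ l hl i
      simp only [Move.apply, Nat.add_sub_cancel] at hl
      simp only [← hg, Function.update_eq_self]
      rw [hT.blank l hl]; rfl
    · simp only [Move.apply, Nat.add_sub_cancel]
      -- One round visits the mark, `h` digits and the blank after them, in both directions: at most
      -- `2 * V.space w.length` steps.
      have : h + 2 ≤ V.space w.length := by simp only [space]; omega
      rw [add_mul]; omega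
  | accept =>
    obtain ⟨j, m, L, v, hR, hm, hpos, hL, hT, hhd, hv, hz, hk⟩ := hc
    dsimp only at hpos hT hhd hv hz hk
    subst hpos
    have hm' := inputAt_succ_eq_rightEnd hx
    have hd0 : hd = 0 := by
      by_contra hne
      obtain ⟨l, rfl⟩ := Nat.exists_eq_succ_of_ne_zero hne
      obtain ⟨f, hf⟩ := hT.bits l (by omega)
      rw [Nat.succ_eq_add_one, hf] at hg
      cases hg
    subst hd0
    have hv0 : v = 0 := by
      funext i
      have := (hv i).symm.trans (tapeValue_eq_zero i fun l => hz rfl l (Nat.zero_le l) i)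
      exact_mod_cast this
    rw [List.take_of_length_le hm'] at hR
    refine ⟨⟨j, hv0 ▸ hR⟩, ?_, rfl⟩
    have : j * (2 * V.space w.length) ≤ (w.length + 1) * (2 * V.space w.length) :=
      Nat.mul_le_mul_right _ hR.le_length
    simp only [time]; omega

theorem inv_of_reachesIn {w : List Δ} {k : ℕ} {c : V.toNTM.Cfg} (h : V.toNTM.ReachesIn w k c) :
    V.Inv w k c := by
  induction h with
  | zero => exact ⟨rfl, rfl⟩
  | succ _ hs ih => exact ih.step hs

variable (V)

theorem toNTM_spaceBounded : V.toNTM.SpaceBounded V.space := by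
  intro w k c h
  have hI := inv_of_reachesIn h
  obtain ⟨s, pos, T, hd⟩ := c
  cases s with
  | start =>
    obtain ⟨-, hI⟩ := hI
    cases hI
    simp [space]
  | back q =>
    obtain ⟨j, m, L, v, -, -, -, hL, -, hhd, -⟩ := hI
    dsimp only at hhd ⊢
    simp only [space]; omega
  | sweep q κ =>
    obtain ⟨j, m, L, h, z, -, -, -, -, -, hL, -, hhd, hh, -⟩ := hI
    dsimp only at hhd ⊢
    simp only [space]; omega
  | accept =>
    obtain ⟨-, -, hhd⟩ := hI
    dsimp only at hhd ⊢
    simp only [space]; omega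

theorem toNTM_timeBounded : V.toNTM.TimeBounded V.time := by
  intro w k c h
  have hI := inv_of_reachesIn h
  have hS := V.toNTM_spaceBounded w k c h
  obtain ⟨s, pos, T, hd⟩ := c
  cases s with
  | start =>
    obtain ⟨rfl, -⟩ := hI
    simp
  | back q =>
    obtain ⟨j, m, L, v, hR, hm, -, -, -, -, -, -, hk⟩ := hI
    have hj := hR.le_length
    rw [List.length_take, min_eq_left hm] at hj
    have : j * (2 * V.space w.length) ≤ (w.length + 1) * (2 * V.space w.length) :=
      Nat.mul_le_mul_right _ (by omega)
    simp only [time]; omega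
  | sweep q κ =>
    obtain ⟨j, m, L, h, z, -, -, hj, -, -, -, -, -, -, -, hk⟩ := hI
    have : j * (2 * V.space w.length) ≤ w.length * (2 * V.space w.length) :=
      Nat.mul_le_mul_right _ hj
    dsimp only at hk hS
    simp only [time, add_mul]; omega
  | accept => exact hI.2.1

/-! ### Completeness -/

variable {V}

/-- The new digit and the new carry of one step of an addition. -/
theorem exists_bit_carry (g : Cell V.Coord) (κ : V.Carry) :
    ∃ (f : V.Coord → Bool) (κ' : V.Carry),
      ∀ i, g.digit i + (κ i : ℤ) = (f i).toInt + 2 * (κ' i : ℤ) := by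
  have hb : (1 : ℤ) ≤ V.bound := by exact_mod_cast V.one_le_bound
  refine ⟨fun i => decide ((g.digit i + (κ i : ℤ)) % 2 = 1),
    fun i => ⟨(g.digit i + (κ i : ℤ)) / 2, ?_, ?_⟩, fun i => ?_⟩
  -- Adding a digit and halving keeps the carry within `[-bound, bound]`, because `1 ≤ bound`.
  · have := (κ i).2.1; have := g.digit_nonneg i; omega
  · have := (κ i).2.2; have := g.digit_le_one i; omega
  · dsimp only
    generalize g.digit i + (κ i : ℤ) = y
    rcases Int.emod_two_eq_zero_or_one y with h | h <;> simp [h] <;> omega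

theorem step_of_trans {w : List Δ} {s s' : V.MState} {pos hd : ℕ} {T : ℕ → Cell V.Coord}
    {g : Cell V.Coord} {m₁ m₂ : Move} (ht : V.Trans s (NTM.inputAt w pos) (T hd) s' g m₁ m₂)
    (hpos : m₁.apply pos ≤ w.length + 1) :
    V.toNTM.Step w ⟨s, pos, T, hd⟩
      ⟨s', m₁.apply pos, (Function.update T hd g : ℕ → Cell V.Coord), m₂.apply hd⟩ := by
  refine ⟨s', g, m₁, m₂, ht, ?_⟩
  rw [min_eq_left hpos]; rfl

theorem step_of_trans_self {w : List Δ} {s s' : V.MState} {pos hd : ℕ} {T : ℕ → Cell V.Coord}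
    {m₁ m₂ : Move} (ht : V.Trans s (NTM.inputAt w pos) (T hd) s' (T hd) m₁ m₂)
    (hpos : m₁.apply pos ≤ w.length + 1) :
    V.toNTM.Step w ⟨s, pos, T, hd⟩ ⟨s', m₁.apply pos, T, m₂.apply hd⟩ := by
  have := step_of_trans ht hpos
  rwa [Function.update_eq_self] at this

/-- The sweep can always be continued until it turns, and it must turn because `toNTM_timeBounded`
excludes an endless computation. The induction runs over the remaining time `n`. -/
theorem exists_reachesIn_turn {w : List Δ} {q : Option V.State} {pos : ℕ}
    (hpos : pos ≤ w.length + 1) {v : V.Coord → ℕ} (n : ℕ) :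
    ∀ {k L h : ℕ} {κ : V.Carry} {T : ℕ → Cell V.Coord},
      V.toNTM.ReachesIn w k ⟨MState.sweep q κ, pos, T, h + 1⟩ → V.time w.length < n + k →
      IsCounterTape T L → h ≤ L → (∀ i, tapeValue T L i + (κ i : ℤ) * 2 ^ h = v i) →
      ∃ k' L' T', V.toNTM.ReachesIn w k' ⟨MState.back q, pos, T', L'⟩ ∧
        IsCounterTape T' L' ∧ ∀ i, tapeValue T' L' i = v i := by
  induction n with
  | zero =>
    intro k L h κ T hR hn
    have := V.toNTM_timeBounded w k _ hR
    omega
  | succ n ih =>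
    intro k L h κ T hR hn hT hh hv
    obtain ⟨f, κ', hf⟩ := exists_bit_carry (T (h + 1)) κ
    have next (ht : V.Trans (.sweep q κ) (NTM.inputAt w pos) (T (h + 1)) (.sweep q κ') (.bits f)
        .stay .right) := by
      exact ih (hR.succ (step_of_trans ht hpos)) (by omega) (hT.update hh f) (by omega)
        fun i => hT.tapeValue_update_add hh (hf i) (hv i)
    rcases hh.lt_or_eq with hlt | rfl
    · obtain ⟨f₀, hf₀⟩ := hT.bits h hlt
      rw [hf₀] at next hf
      exact next (.add _ hf)
    · have hbl := hT.blank h le_rfl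
      by_cases h0 : ∀ i, (κ i : ℤ) = 0
      · have ht : V.Trans (.sweep q κ) (NTM.inputAt w pos) (T (h + 1)) (.back q)
            (T (h + 1)) .stay .left := by
          rw [hbl]; exact .turn _ h0
        exact ⟨_, _, _, hR.succ (step_of_trans_self ht hpos), hT, fun i => by simpa [h0, Move.apply] using hv i⟩
      -- The digits represent less than `2 ^ h`, so a negative carry would make `v i` negative.
      · have hnn : ∀ i, 0 ≤ (κ i : ℤ) := by
          intro i
          by_contra! hneg
          have h1 : tapeValue T h i < 2 ^ h := by
            have : tapeValue T h i ≤ ∑ j ∈ Finset.range h, 2 ^ j :=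
              Finset.sum_le_sum fun j _ =>
                mul_le_of_le_one_left (by positivity) (Cell.digit_le_one _ _)
            have h2 := geom_sum_mul (2 : ℤ) h
            omega
          have h2 := hv i
          have h3 : (κ i : ℤ) * 2 ^ h ≤ (-1) * 2 ^ h :=
            mul_le_mul_of_nonneg_right (by omega) (by positivity)
          have h4 : (0 : ℤ) ≤ v i := by positivity
          linarith
        push Not at h0
        obtain ⟨i₀, hi₀⟩ := h0
        rw [hbl] at next hf
        exact next (.extend _ hnn ⟨i₀, lt_of_le_of_ne (hnn i₀) (Ne.symm hi₀)⟩
          (by simpa [Cell.digit] using hf))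

theorem exists_reachesIn_mark {w : List Δ} {q : Option V.State} {pos : ℕ}
    (hpos : pos ≤ w.length + 1) {L : ℕ} {T : ℕ → Cell V.Coord} (hT : IsCounterTape T L)
    (hq : q = none → ∀ i, tapeValue T L i = 0) (h : ℕ) :
    ∀ {k : ℕ}, h ≤ L → V.toNTM.ReachesIn w k ⟨MState.back q, pos, T, h⟩ →
      ∃ k', V.toNTM.ReachesIn w k' ⟨MState.back q, pos, T, 0⟩ := by
  induction h with
  | zero => exact fun _ hR => ⟨_, hR⟩
  | succ h ih =>
    intro k hL hR
    obtain ⟨f, hf⟩ := hT.bits h hL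
    have ht : V.Trans (.back q) (NTM.inputAt w pos) (T (h + 1)) (.back q)
        (T (h + 1)) .stay .left := by
      rw [hf]
      refine .back _ fun hn i => ?_
      have := digit_eq_zero_of_tapeValue i (hq hn i) hL
      rw [hf] at this
      cases hfi : f i <;> simp_all [Cell.digit]
    exact ih (by omega) (hR.succ (step_of_trans_self ht hpos))

theorem Reach.exists_reachesIn {w : List Δ} {j : ℕ} {u : List Δ} {q : Option V.State}
    {v : V.Coord → ℕ} (hV : V.Reach j u q v) (hu : u <+: w) (hq : q = none → v = 0) :
    ∃ k T L, V.toNTM.ReachesIn w k ⟨MState.back q, u.length + 1, T, 0⟩ ∧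
      IsCounterTape T L ∧ ∀ i, tapeValue T L i = v i := by
  induction hV with
  | zero =>
    refine ⟨1, Function.update (fun _ => .blank) 0 .mark, 0, ?_,
      isCounterTape_mark, by simp [tapeValue]⟩
    exact NTM.ReachesIn.zero.succ
      (step_of_trans (w := w) (pos := 1) (hd := 0) (T := fun _ => .blank) (.init (V := V) _ _)
        (by simp [Move.apply]))
  | @step j u p v v' o d q _ ht hv' ih =>
    obtain ⟨k, T, L, hR, hT, hv⟩ := ih ((List.prefix_append _ _).trans hu) (by simp)
    have hlen := hu.length_le
    rw [List.length_append] at hlen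
    let κ : V.Carry := fun i => ⟨d i, V.change_mem _ _ _ _ ht i⟩
    have hsum : ∀ i, tapeValue T L i + (κ i : ℤ) * 2 ^ 0 = v' i := fun i => by
      simp [hv, hv', κ]
    have hsweep : ∃ k', V.toNTM.ReachesIn w k'
        ⟨MState.sweep q κ, (u ++ o.toList).length + 1, T, 0 + 1⟩ := by
      cases o with
      | none =>
        have hst : V.Trans (.back (some p)) (NTM.inputAt w (u.length + 1)) (T 0) (.sweep q κ)
            (T 0) .stay .right := by
          rw [hT.mark]; exact .finish _ ht
        have hR' := hR.succ (step_of_trans_self hst (by simp only [Move.apply]; omega))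
        exact ⟨_, by simpa [Move.apply] using hR'⟩
      | some a =>
        have hin : NTM.inputAt w (u.length + 1) = .letter a := by
          obtain ⟨t, rfl⟩ := hu
          simp [NTM.inputAt]
        have hst : V.Trans (.back (some p)) (NTM.inputAt w (u.length + 1)) (T 0) (.sweep q κ)
            (T 0) .right .right := by
          rw [hT.mark, hin]; exact .read ht
        simp only [Option.toList_some, List.length_singleton] at hlen
        have hR' := hR.succ (step_of_trans_self hst (by simp only [Move.apply]; omega))
        exact ⟨_, by simpa [Move.apply] using hR'⟩
    have hpos : (u ++ o.toList).length + 1 ≤ w.length + 1 := by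
      rw [List.length_append]; omega
    obtain ⟨k', hk'⟩ := hsweep
    obtain ⟨k₂, L₂, T₂, hR₂, hT₂, hv₂⟩ :=
      exists_reachesIn_turn hpos (V.time w.length + 1) hk' (by omega) hT (Nat.zero_le L) hsum
    obtain ⟨k₃, hR₃⟩ := exists_reachesIn_mark hpos hT₂
      (fun hn i => by simp [hv₂, hq hn]) L₂ le_rfl hR₂
    exact ⟨k₃, T₂, L₂, hR₃, hT₂, hv₂⟩

variable (V)

theorem toNTM_language : V.toNTM.language = V.language := by
  ext w
  constructor
  · rintro ⟨k, c, hR, hc⟩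
    have hI := inv_of_reachesIn hR
    obtain ⟨s, pos, T, hd⟩ := c
    obtain rfl : s = MState.accept := hc
    exact hI.1
  · rintro ⟨j, hV⟩
    obtain ⟨k, T, L, hR, hT, -⟩ := hV.exists_reachesIn (List.prefix_refl w) fun _ => rfl
    have hin : NTM.inputAt w (w.length + 1) = .rightEnd := by simp [NTM.inputAt]
    have hst : V.Trans (.back none) (NTM.inputAt w (w.length + 1)) (T 0) .accept .mark
        .stay .stay := by
      rw [hT.mark, hin]; exact .accept
    exact ⟨_, _, hR.succ (step_of_trans hst (by simp [Move.apply])), rfl⟩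

/-! ### Growth of the bounds -/

theorem space_isBigO : (fun n => (V.space n : ℝ)) =O[atTop] fun n : ℕ => Real.log n := by
  have hb : (1 : ℝ) ≤ V.bound := by exact_mod_cast V.one_le_bound
  have hlog2 : 0 < Real.log 2 := Real.log_pos (by norm_num)
  have key : ∀ᶠ n : ℕ in atTop, ‖(V.space n : ℝ)‖ ≤
      (2 / Real.log 2) * ‖Real.log n‖ + (Real.log V.bound / Real.log 2 + 3) * ‖(1 : ℝ)‖ := by
    filter_upwards [eventually_ge_atTop 2] with n hn
    have hn' : (2 : ℝ) ≤ n := by exact_mod_cast hn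
    have h1 : (Nat.log 2 (V.bound * (n + 1)) : ℝ) ≤ Real.logb 2 ((V.bound * (n + 1) : ℕ) : ℝ) := by
      exact_mod_cast Real.natLog_le_logb (V.bound * (n + 1)) 2
    have h2 : Real.log ((V.bound * (n + 1) : ℕ) : ℝ) ≤ Real.log V.bound + 2 * Real.log n := by
      push_cast
      rw [Real.log_mul (by positivity) (by positivity), ← Nat.cast_two, ← Real.log_pow]
      gcongr
      -- For `n ≥ 2` one has `n + 1 ≤ n ^ 2`, whence the factor `2` of the logarithm.
      nlinarith
    have h3 : Real.logb 2 ((V.bound * (n + 1) : ℕ) : ℝ) ≤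
        (Real.log V.bound + 2 * Real.log n) / Real.log 2 := by
      rw [Real.logb]; gcongr
    have h4 : (Real.log V.bound + 2 * Real.log n) / Real.log 2 =
        2 / Real.log 2 * Real.log n + Real.log V.bound / Real.log 2 := by ring
    rw [Real.norm_of_nonneg (by positivity), Real.norm_of_nonneg (Real.log_nonneg (by linarith)),
      norm_one]
    simp only [space, maxDigits]
    push_cast
    linarith
  have h1 : (fun _ : ℕ => (1 : ℝ)) =O[atTop] fun n : ℕ => Real.log n :=
    (Real.isLittleO_const_log_atTop.comp_tendsto tendsto_natCast_atTop_atTop).isBigO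
  refine (IsBigO.of_bound 1 ?_).trans
    (((isBigO_refl (fun n : ℕ => Real.log n) atTop).norm_left.const_mul_left (2 / Real.log 2)).add
      (h1.norm_left.const_mul_left (Real.log V.bound / Real.log 2 + 3)))
  filter_upwards [key] with n hn
  rw [one_mul]
  exact hn.trans (le_abs_self _)

theorem time_isBigO : (fun n => (V.time n : ℝ)) =O[atTop] fun n : ℕ => n * Real.log n := by
  have h : (fun n => (V.time n : ℝ)) =O[atTop] fun n : ℕ => (n : ℝ) * V.space n := by
    refine IsBigO.of_bound 6 ?_
    filter_upwards [eventually_ge_atTop 1] with n hn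
    have hS : 2 ≤ V.space n := by simp [space]
    have : V.time n ≤ 6 * (n * V.space n) := by simp only [time]; nlinarith
    rw [Real.norm_of_nonneg (by positivity), Real.norm_of_nonneg (by positivity)]
    exact_mod_cast this
  exact h.trans ((isBigO_refl _ _).mul V.space_isBigO)

end CounterSystem

/-! ### The derivations of real-time systems -/

theorem forall₂_map_inl {A : Type} (r : A × List A) (u : List A) (ys : List (List A)) :
    List.Forall₂ (fun c v => Sum.elim (fun a => v = [a]) (fun a => (a, v) = r) c)
      (u.map (Sum.inl : A → Marked A)) ys ↔ ys = u.map fun a => [a] := by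
  induction u generalizing ys with
  | nil => simp
  | cons a u ih => cases ys <;> simp [ih]

theorem flatten_map_singleton {A : Type} (u : List A) : (u.map fun a => [a]).flatten = u := by
  induction u <;> simp_all

theorem forall₂_marked {A : Type} (r : A × List A) (s t : List A) (a : A) (ys : List (List A)) :
    List.Forall₂ (fun c v => Sum.elim (fun a => v = [a]) (fun a => (a, v) = r) c)
      (s.map Sum.inl ++ (Sum.inr a : Marked A) :: t.map Sum.inl) ys ↔
      r.1 = a ∧ ys = (s.map fun a => [a]) ++ r.2 :: t.map fun a => [a] := by
  induction s generalizing ys with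
  | nil =>
    obtain ⟨b, v⟩ := r
    cases ys with
    | nil => simp
    | cons y ys =>
      rw [List.map_nil, List.nil_append, List.forall₂_cons, forall₂_map_inl]
      simp [@eq_comm _ a, and_assoc]
  | cons c s ih =>
    cases ys <;> simp [ih, and_left_comm]

theorem ZSGrammar.derivesUsing_iff (G : ZSGrammar) (r : G.A × List G.A) (x y : List G.A) :
    G.table.DerivesUsing r x y ↔
      r ∈ G.prod ∧ ∃ s t, x = s ++ r.1 :: t ∧ y = s ++ r.2 ++ t := by
  refine and_congr Iff.rfl ⟨?_, ?_⟩
  · rintro ⟨z, ⟨s, a, t, rfl⟩, ys, rfl, rfl, h⟩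
    obtain ⟨rfl, rfl⟩ := (forall₂_marked _ _ _ _ _).1 h
    exact ⟨s, t, by simp [unbar, Function.comp_def],
      by simp [flatten_map_singleton]⟩
  · rintro ⟨s, t, rfl, rfl⟩
    exact ⟨_, ⟨s, r.1, t, rfl⟩, _, by simp [unbar, Function.comp_def],
      by simp [flatten_map_singleton], (forall₂_marked _ _ _ _ _).2 ⟨rfl, rfl⟩⟩

theorem RLGrammar.derivesUsing_iff {Δ : Type} (G : RLGrammar Δ)
    (r : Symbol Δ G.N × List (Symbol Δ G.N)) (x y : List (Symbol Δ G.N)) :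
    G.table.DerivesUsing r x y ↔ r ∈ G.prod ∧ ∃ (u : List Δ) (X : G.N),
      r.1 = .nonterminal X ∧ x = u.map .terminal ++ [.nonterminal X] ∧
      y = u.map .terminal ++ r.2 := by
  refine and_congr Iff.rfl ⟨?_, ?_⟩
  · rintro ⟨z, ⟨u, X, rfl⟩, ys, rfl, rfl, h⟩
    have := (forall₂_marked r (u.map .terminal) [] (.nonterminal X) ys).1
      (by simpa [Function.comp_def] using h)
    obtain ⟨hr, rfl⟩ := this
    exact ⟨u, X, hr, by simp [unbar, Function.comp_def],
      by rw [List.flatten_append, flatten_map_singleton]; simp⟩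
  · rintro ⟨u, X, hr, rfl, rfl⟩
    refine ⟨_, ⟨u, X, rfl⟩, ((u.map .terminal).map fun a => [a]) ++ [r.2],
      by simp [unbar, Function.comp_def],
      by rw [List.flatten_append, flatten_map_singleton]; simp, ?_⟩
    have := (forall₂_marked r (u.map .terminal) [] (.nonterminal X) _).2 ⟨hr, rfl⟩
    simpa [Function.comp_def] using this

/-- Without chain rules, a right-hand side that has no terminal is empty; this is the shape of the
transitions of a counter system. -/
theorem RLGrammar.IsRealTime.cases {Δ : Type} {G : RLGrammar Δ} (hG : G.IsRealTime) {X : G.N}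
    {α : List (Symbol Δ G.N)} (h : (.nonterminal X, α) ∈ G.prod) :
    ∃ (o : Option Δ) (Y : Option G.N), (o = none → Y = none) ∧
      α = o.toList.map .terminal ++ Y.toList.map .nonterminal := by
  obtain ⟨-, ⟨σ, hσ⟩ | h0 | ⟨a, Y, hY⟩⟩ := G.rightLinear _ h
  · dsimp only at hσ
    subst hσ
    cases σ with
    | terminal a => exact ⟨some a, none, by simp⟩
    | nonterminal Y => exact absurd h (hG X Y)
  · exact ⟨none, none, by simpa using h0⟩
  · exact ⟨some a, some Y, by simpa using hY⟩

/-! ### Real-time systems as counter systems -/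

namespace RL0SSystem

variable {Δ : Type} (G : RL0SSystem Δ)

open Classical in
/-- The change of the numbers of letters when `v` is produced and the letter `b` (if any) is then
set apart. -/
noncomputable def change (v : List G.G₂.A) (b : Option G.G₂.A) (i : G.G₂.A) : ℤ :=
  v.count i - b.toList.count i

/-- A bound for the lengths of the right-hand sides of the second component. -/
def maxLength : ℕ := (G.G₂.prod.sup fun r => r.2.length) + 1

/-- The counter system of a real-time system. A state consists of the nonterminal of the first
component and of the letter of the second component which is rewritten next; the counters are the
numbers of the remaining letters of the second component. -/
noncomputable def toCounterSystem : CounterSystem Δ where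
  State := G.G₁.N × G.G₂.A
  finite_State := by have := G.G₁.finite; have := G.G₂.finite; infer_instance
  Coord := G.G₂.A
  finite_Coord := G.G₂.finite
  start := (G.G₁.ax, G.G₂.ax)
  trans p o d q := (o = none → q = none) ∧ ∃ v : List G.G₂.A, v.length ≤ G.maxLength ∧
    ((.nonterminal p.1, o.toList.map .terminal ++ (q.map Prod.fst).toList.map .nonterminal),
      (p.2, v)) ∈ G.rew ∧ d = G.change v (q.map Prod.snd)
  bound := G.maxLength
  one_le_bound := Nat.le_add_left 1 _
  change_mem := by
    classical
    -- An entry is a letter count of `v` minus `0` or `1`; the summand `1` in `maxLength` makes room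
    -- for the value `-1`.
    rintro p o d q ⟨-, v, hv, -, rfl⟩ i
    have h1 : v.count i ≤ v.length := List.count_le_length
    have h2 : (q.map Prod.snd).toList.count i ≤ 1 :=
      List.count_le_length.trans (by cases q <;> simp)
    have h3 : 1 ≤ G.maxLength := Nat.le_add_left 1 _
    simp only [change, Set.mem_Icc]
    convert_to (-(G.maxLength : ℤ) ≤ (v.count i : ℤ) - ((q.map Prod.snd).toList.count i : ℤ) ∧
      (v.count i : ℤ) - ((q.map Prod.snd).toList.count i : ℤ) ≤ G.maxLength)
    omega
  eq_none_of_trans_none := fun _ _ _ h => h.1 rfl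

variable {G}

theorem length_le_maxLength {r : (Symbol Δ G.G₁.N × List (Symbol Δ G.G₁.N)) × (G.G₂.A × List G.G₂.A)}
    (hr : r ∈ G.rew) : r.2.2.length ≤ G.maxLength :=
  (Finset.le_sup (f := fun r => r.2.length) (G.rew_subset r hr).2).trans (Nat.le_succ _)

open Classical in
/-- A word of the second component is described by the letter `b` (if any) set apart and by the
numbers `c` of the other letters. -/
def Splits (y : List G.G₂.A) (b : Option G.G₂.A) (c : G.G₂.A → ℕ) : Prop :=
  ∀ i, y.count i = c i + b.toList.count i

/-- The words of the first component: terminals, then at most one nonterminal. -/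
def sentential (u : List Δ) (X : Option G.G₁.N) : List (Symbol Δ G.G₁.N) :=
  u.map .terminal ++ X.toList.map .nonterminal

theorem sentential_injective {u u' : List Δ} {X X' : Option G.G₁.N}
    (h : sentential u X = sentential u' X') : u = u' ∧ X = X' := by
  induction u generalizing u' with
  | nil =>
    cases u' with
    | nil => cases X <;> cases X' <;> simp_all [sentential]
    | cons a u' => cases X <;> simp [sentential] at h
  | cons a u ih =>
    cases u' with
    | nil => cases X' <;> simp [sentential] at h
    | cons a' u' =>
      simp only [sentential, List.map_cons, List.cons_append, List.cons.injEq,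
        Symbol.terminal.injEq] at h
      have := ih h.2
      simp [h.1, this.1, this.2]

/-- The letter set apart is a guess about the next step, which a derivation so far does not
determine. The induction therefore carries all possible choices of `q` and `c`. -/
theorem reach_of_derives (hG : G.G₁.IsRealTime)
    {x : List (Symbol Δ G.G₁.N) × List G.G₂.A}
    (h : Relation.ReflTransGen G.Derives ([.nonterminal G.G₁.ax], [G.G₂.ax]) x) :
    ∃ (u : List Δ) (X : Option G.G₁.N), x.1 = sentential u X ∧
      ∀ (q : Option (G.G₁.N × G.G₂.A)) (c : G.G₂.A → ℕ), q.map Prod.fst = X →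
        Splits x.2 (q.map Prod.snd) c → ∃ j, G.toCounterSystem.Reach j u q c := by
  classical
  induction h with
  | refl =>
    refine ⟨[], some G.G₁.ax, rfl, ?_⟩
    rintro (_ | ⟨X, b⟩) c hX hc
    · simp at hX
    · obtain rfl : X = G.G₁.ax := by simpa using hX
      have hb : b = G.G₂.ax := by
        have := hc b
        by_contra hne
        simp [Ne.symm hne] at this
      subst hb
      obtain rfl : c = 0 := by
        funext i
        have := hc i
        simpa using this
      exact ⟨0, .zero⟩
  | @tail x y _ hd ih =>
    obtain ⟨u, X, hx, ih⟩ := ih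
    obtain ⟨⟨⟨σ, α⟩, ⟨a, v⟩⟩, hr, h₁, h₂⟩ := hd
    rw [RLGrammar.derivesUsing_iff] at h₁
    rw [ZSGrammar.derivesUsing_iff] at h₂
    obtain ⟨hα, u', X', rfl, hx', hy⟩ := h₁
    obtain ⟨-, s, t, hx₂, hy₂⟩ := h₂
    obtain ⟨rfl, rfl⟩ := sentential_injective (u' := u') (X' := some X')
      (hx.symm.trans (hx'.trans (by simp [sentential])))
    obtain ⟨o, Y, ho, rfl⟩ := hG.cases hα
    refine ⟨u ++ o.toList, Y, by simp [hy, sentential], fun q c hq hc => ?_⟩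
    subst hq
    -- The right guess is the letter `a` that this step rewrites; the counters then describe its
    -- context `s ++ t`.
    obtain ⟨j, hj⟩ := ih (some (X', a)) (fun i => (s ++ t).count i) rfl fun i => by
      simp [hx₂, List.count_cons]; omega
    refine ⟨j + 1, hj.step (o := o) (d := G.change v (q.map Prod.snd))
      ⟨by simpa using ho, v, length_le_maxLength hr, hr, rfl⟩ fun (i : G.G₂.A) => ?_⟩
    have h₁ : y.2.count i = c i + (q.map Prod.snd).toList.count i := hc i
    rw [hy₂, List.count_append, List.count_append] at h₁
    dsimp only at h₁
    change (c i : ℤ) = ((s ++ t).count i : ℕ) + ((v.count i : ℤ) - (q.map Prod.snd).toList.count i)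
    rw [List.count_append]
    omega

/-- Any word with the right letter counts serves: the letter set apart occurs in it, and whichever
occurrence is rewritten, the new counts are the same. -/
theorem derives_of_reach {j : ℕ} {u : List Δ} {q : Option G.toCounterSystem.State}
    {c : G.toCounterSystem.Coord → ℕ} (h : G.toCounterSystem.Reach j u q c) :
    ∃ y, Splits y (q.map (Prod.snd : G.G₁.N × G.G₂.A → G.G₂.A)) c ∧
      Relation.ReflTransGen G.Derives ([.nonterminal G.G₁.ax], [G.G₂.ax])
        (sentential u (q.map (Prod.fst : G.G₁.N × G.G₂.A → G.G₁.N)), y) := by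
  classical
  induction h with
  | zero => exact ⟨[G.G₂.ax], fun i => (Nat.zero_add _).symm, .refl⟩
  | @step j u p c c' o d q _ ht hc' ih =>
    obtain ⟨y, hy, hd⟩ := ih
    obtain ⟨X, b⟩ := p
    obtain ⟨-, v, -, hr, rfl⟩ := ht
    have hb : b ∈ y := List.count_pos_iff.1 (by
      have h₁ : y.count b = c b + [b].count b := hy b
      simp [h₁])
    obtain ⟨s, t, rfl⟩ := List.append_of_mem hb
    refine ⟨s ++ v ++ t, fun i => ?_, hd.tail ⟨_, hr, ?_, ?_⟩⟩
    · have h₁ : (s ++ b :: t).count i = c i + [b].count i := hy i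
      have h₂ : (c' i : ℤ) = c i + ((v.count i : ℤ) - (q.map Prod.snd).toList.count i) := hc' i
      simp only [List.count_append, List.count_cons, List.count_nil] at h₁ ⊢
      omega
    · rw [RLGrammar.derivesUsing_iff]
      exact ⟨(G.rew_subset _ hr).1, u, X, rfl, rfl, by simp [sentential]⟩
    · rw [ZSGrammar.derivesUsing_iff]
      exact ⟨(G.rew_subset _ hr).2, s, t, rfl, rfl⟩

theorem toCounterSystem_language (hG : G.G₁.IsRealTime) :
    G.toCounterSystem.language = G.language := by
  classical
  ext w
  constructor
  · rintro ⟨j, hj⟩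
    obtain ⟨y, hy, hd⟩ := derives_of_reach hj
    obtain rfl : y = [] := by
      refine List.eq_nil_iff_forall_not_mem.2 fun a ha => ?_
      have h1 := List.count_pos_iff.2 ha
      have h2 : y.count a = 0 := hy a
      omega
    have : sentential w (none : Option G.G₁.N) = w.map .terminal := by simp [sentential]
    change Relation.ReflTransGen G.Derives _ _ at hd ⊢
    rw [← this]
    exact hd
  · intro hw
    obtain ⟨u, X, hx, h⟩ := reach_of_derives hG hw
    obtain ⟨rfl, rfl⟩ := sentential_injective (X := none)
      ((show sentential w none = w.map .terminal by simp [sentential]).trans hx)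
    exact h none 0 rfl fun i => by simp

end RL0SSystem

end CTS

theorem theorem3p2 (Δ : Type) [Finite Δ] :
    (∀ L ∈ CTS.LrtRL0S Δ, ∃ (M : CTS.NTM Δ) (s t : ℕ → ℕ),
      M.OnLine ∧ M.language = L ∧ M.SpaceBounded s ∧ M.TimeBounded t ∧
      (fun n => (s n : ℝ)) =O[atTop] (fun n : ℕ => Real.log n) ∧
      (fun n => (t n : ℝ)) =O[atTop] (fun n : ℕ => n * Real.log n)) ∧
    CTS.LrtRL0S Δ ⊆ CTS.NSPACE Δ (fun n : ℕ => Real.log n) := by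
  have h : ∀ L ∈ CTS.LrtRL0S Δ, ∃ (M : CTS.NTM Δ) (s t : ℕ → ℕ),
      M.OnLine ∧ M.language = L ∧ M.SpaceBounded s ∧ M.TimeBounded t ∧
      (fun n => (s n : ℝ)) =O[atTop] (fun n : ℕ => Real.log n) ∧
      (fun n => (t n : ℝ)) =O[atTop] (fun n : ℕ => n * Real.log n) := by
    rintro L ⟨G, hG, rfl⟩
    let V := G.toCounterSystem
    exact ⟨V.toNTM, V.space, V.time, V.toNTM_onLine,
      V.toNTM_language.trans (CTS.RL0SSystem.toCounterSystem_language hG),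
      V.toNTM_spaceBounded, V.toNTM_timeBounded, V.space_isBigO, V.time_isBigO⟩
  refine ⟨h, fun L hL => ?_⟩
  obtain ⟨M, s, t, -, hM, hs, -, hO, -⟩ := h L hL
  exact ⟨M, s, hM, hs, hO⟩
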